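/- Let $\mathbb K$ be a field, let $n\ge 1$, let $m=(m_1,\dots,m_n)$ be a nonzero sequence of nonnegative integers with $m_n=0$, and let $p=\max\{j\in\{1,\dots,n\}: m_j\neq 0\}$. The intersection complex $\mathcal I(m)$ is the simplicial complex whose vertices are the symbols $v_S^r$, where $S$ is a nonempty subset of $[n]=\{1,\dots,n\}$ and $1\le r\le m_{|S|}$, and which is generated by the sets $F_1,\dots,F_n$ with $F_j=\{v_S^r : j\in S\}$ (that is, its faces are the subsets of the $F_j$, including $\emptyset$). For a face $\sigma$ of a simplicial complex $\Delta$ let $\operatorname{link}_\Delta\sigma=\{\tau\in\Delta : \sigma\cap\tau=\emptyset,\ \sigma\cup\tau\in\Delta\}$, and let $\widetilde H_i$ denote reduced simplicial homology over $\mathbb K$ (so $\widetilde H_{-1}(\{\emptyset\})\ne 0$). The complex $\Delta$ is PR (over $\mathbb K$) if for every $i\geq -1$ and all faces $\sigma,\tau$ of $\Delta$ with $\widetilde H_i(\operatorname{link}_\Delta\sigma)\neq 0\neq \widetilde H_i(\operatorname{link}_\Delta\tau)$ we have $|\sigma|=|\tau|$. The degree type of a PR complex $\Delta$ is the sequence $(d_q,\dots,d_1)$,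 where $q$ is the largest index for which $\widetilde H_{q-1}(\operatorname{link}_\Delta\sigma)\ne 0$ for some face $\sigma$, where for $0\le i\le q$ the number $s_i$ is the common size of the faces $\sigma$ with $\widetilde H_{i-1}(\operatorname{link}_\Delta\sigma)\ne0$ (such faces exist for each such $i$), and where $d_i=s_{i-1}-s_i$ for $1\le i\le q$. Theorem. The complex $\mathcal I(m)$ is PR with degree type $(d_p,\dots,d_1)$, where for each $1\le i\le p$ $$d_i=\sum_{j=0}^{n-i-1}\binom{n-i-1}{j}\,m_{i+j}.$$ -/

import Mathlib

namespace PRComplex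

/-! ### Simplicial complexes containing the empty face, links -/

/-- A simplicial complex on the vertex set `V`: a set of finite subsets of `V` that is closed
under passing to subsets. The empty set is a face of every complex that has a face at all;
`{∅}` (the irrelevant complex) and the void complex are different complexes. -/
abbrev Complex (V : Type*) := LowerSet (Finset V)

/-- The link `{τ ∈ Δ | σ ∩ τ = ∅ and σ ∪ τ ∈ Δ}` of `σ` in `Δ`. -/
def link {V : Type*} [DecidableEq V] (Δ : Complex V) (σ : Finset V) : Complex V where
  carrier := {τ | τ ∈ Δ ∧ Disjoint σ τ ∧ σ ∪ τ ∈ Δ}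
  lower' := by
    intro a b hba ha
    exact ⟨Δ.lower hba ha.1, ha.2.1.mono_right hba,
      Δ.lower (Finset.union_subset_union_right hba) ha.2.2⟩

/-- `⟨F_j : j ∈ ι⟩`: the smallest simplicial complex that contains all the sets `F j`. -/
def generated {V ι : Type*} (F : ι → Finset V) : Complex V :=
  lowerClosure (Set.range F)

/-! ### Reduced simplicial homology

A fixed total order on the vertex set (`WellOrderingRel`) is used only for the signs. -/

open scoped Classical in
/-- The position (counted from `0`) of the vertex `v` in `σ`. -/
noncomputable def position {V : Type*} (σ : Finset V) (v : V) : ℕ :=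
  (σ.filter (fun u => WellOrderingRel u v)).card

/-- The simplicial boundary map
`[v₀, …, v_q] ↦ ∑ i, (-1) ^ i [v₀, …, v̂_i, …, v_q]` with `v₀ < ⋯ < v_q`, on the free module
on all finite subsets of `V`. It sends a single vertex to `[∅]` and `[∅]` to `0`. -/
noncomputable def boundary (K : Type*) [Field K] {V : Type*} [DecidableEq V] :
    (Finset V →₀ K) →ₗ[K] (Finset V →₀ K) :=
  Finsupp.linearCombination K fun σ =>
    ∑ v ∈ σ, Finsupp.single (σ.erase v) ((-1 : K) ^ position σ v)

/-- The simplicial chains with basis the faces of `Δ` of size `k`, i.e. of dimension `k - 1`. -/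
noncomputable def chains (K : Type*) [Field K] {V : Type*} (Δ : Complex V) (k : ℕ) :
    Submodule K (Finset V →₀ K) :=
  Finsupp.supported K K {σ | σ ∈ Δ ∧ σ.card = k}

/-- The reduced cycles of dimension `k - 1`. -/
noncomputable def cycles (K : Type*) [Field K] {V : Type*} [DecidableEq V] (Δ : Complex V)
    (k : ℕ) : Submodule K (Finset V →₀ K) :=
  chains K Δ k ⊓ LinearMap.ker (boundary K)

/-- The boundaries of dimension `k - 1`. -/
noncomputable def boundaries (K : Type*) [Field K] {V : Type*} [DecidableEq V] (Δ : Complex V)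
    (k : ℕ) : Submodule K (Finset V →₀ K) :=
  (chains K Δ (k + 1)).map (boundary K)

theorem boundary_single (K : Type*) [Field K] {V : Type*} [DecidableEq V] (σ : Finset V) (a : K) :
    boundary K (Finsupp.single σ a) =
      ∑ v ∈ σ, Finsupp.single (σ.erase v) (a * (-1 : K) ^ position σ v) := by
  simp [boundary, Finsupp.linearCombination_single, Finset.smul_sum]

theorem position_erase_of_rel {V : Type*} [DecidableEq V] (σ : Finset V) {u v : V}
    (hu : u ∈ σ) (h : WellOrderingRel u v) :
    position σ v = position (σ.erase u) v + 1 := by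
  classical
  have hmem : u ∈ σ.filter (fun w => WellOrderingRel w v) := by simp [hu, h]
  have hpos := Finset.card_pos.mpr ⟨u, hmem⟩
  have hcard := Finset.card_erase_of_mem hmem
  rw [← Finset.filter_erase] at hcard
  simp only [position]
  omega

theorem position_erase_of_not_rel {V : Type*} [DecidableEq V] (σ : Finset V) {u v : V}
    (h : ¬ WellOrderingRel u v) : position (σ.erase u) v = position σ v := by
  classical
  simp only [position]
  rw [Finset.filter_erase, Finset.erase_eq_of_notMem (by simp [h])]

/-- `∂ ∘ ∂ = 0`. -/
theorem boundary_boundary (K : Type*) [Field K] {V : Type*} [DecidableEq V]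
    (c : Finset V →₀ K) : boundary K (boundary K c) = 0 := by
  suffices h : boundary K ∘ₗ boundary K = (0 : (Finset V →₀ K) →ₗ[K] (Finset V →₀ K)) from
    LinearMap.congr_fun h c
  refine Finsupp.lhom_ext fun σ a => ?_
  simp only [LinearMap.comp_apply, boundary_single, map_sum, LinearMap.zero_apply]
  rw [Finset.sum_sigma']
  refine Finset.sum_involution (fun x _ => ⟨x.2, x.1⟩) ?_ ?_ ?_ ?_
  · rintro ⟨u, v⟩ h
    simp only [Finset.mem_sigma, Finset.mem_erase] at h
    obtain ⟨hu, hvu, hv⟩ := h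
    dsimp only
    rw [Finset.erase_right_comm, ← Finsupp.single_add, Finsupp.single_eq_zero]
    rcases trichotomous_of (WellOrderingRel (α := V)) u v with h | h | h
    · rw [position_erase_of_rel σ hu h, position_erase_of_not_rel σ (asymm_of _ h)]
      ring
    · exact absurd h.symm hvu
    · rw [position_erase_of_rel σ hv h, position_erase_of_not_rel σ (asymm_of _ h)]
      ring
  · rintro ⟨u, v⟩ h _ he
    simp only [Finset.mem_sigma, Finset.mem_erase] at h
    simp only [Sigma.mk.injEq] at he
    exact h.2.1 he.1
  · rintro ⟨u, v⟩ h
    simp only [Finset.mem_sigma, Finset.mem_erase] at h ⊢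
    exact ⟨h.2.2, h.2.1.symm, h.1⟩
  · rintro ⟨u, v⟩ _; rfl

theorem boundaries_le_cycles (K : Type*) [Field K] {V : Type*} [DecidableEq V]
    (Δ : Complex V) (k : ℕ) : boundaries K Δ k ≤ cycles K Δ k := by
  refine le_inf ?_ ?_
  · rw [boundaries, Submodule.map_le_iff_le_comap, chains, Finsupp.supported_eq_span_single,
      Submodule.span_le]
    rintro _ ⟨σ, ⟨hσ, hc⟩, rfl⟩
    rw [SetLike.mem_coe, Submodule.mem_comap, boundary_single]
    refine Submodule.sum_mem _ fun v hv => Finsupp.single_mem_supported K _ ⟨?_, ?_⟩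
    · exact Δ.lower (Finset.erase_subset v σ) hσ
    · rw [Finset.card_erase_of_mem hv, hc]; rfl
  · rintro _ ⟨c, _, rfl⟩
    exact boundary_boundary K c

/-- The quotient `Z / (B ∩ Z)` for submodules `Z`, `B` of a common module. -/
abbrev SubmoduleQuotient {K M : Type*} [Field K] [AddCommGroup M] [Module K M]
    (Z B : Submodule K M) : Type _ :=
  Z ⧸ B.submoduleOf Z

/-- The reduced simplicial homology `H̃_{k-1}(Δ; K)`. The index is shifted by one, so that `k = 0`
is homology in degree `-1`. -/
abbrev ReducedHomology (K : Type*) [Field K] {V : Type*} [DecidableEq V] (Δ : Complex V)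
    (k : ℕ) : Type _ :=
  SubmoduleQuotient (cycles K Δ k) (boundaries K Δ k)

/-! ### PR complexes and their degree types -/

/-- The sizes of the faces `σ` of `Δ` with `H̃_{i-1}(link_Δ σ; K) ≠ 0`. -/
def linkHomologySizes (K : Type*) [Field K] {V : Type*} [DecidableEq V] (Δ : Complex V)
    (i : ℕ) : Set ℕ :=
  {s | ∃ σ ∈ Δ, Nontrivial (ReducedHomology K (link Δ σ) i) ∧ σ.card = s}

/-- `Δ` is PR over `K`: any two faces whose links have nonzero reduced homology in a common
degree have the same size. -/
def IsPR (K : Type*) [Field K] {V : Type*} [DecidableEq V] (Δ : Complex V) : Prop :=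
  ∀ i : ℕ, ∀ σ ∈ Δ, ∀ τ ∈ Δ,
    Nontrivial (ReducedHomology K (link Δ σ) i) →
    Nontrivial (ReducedHomology K (link Δ τ) i) → σ.card = τ.card

/-- The finite sequence `(d_p, …, d_1)`. -/
def descendingSeq (p : ℕ) (d : ℕ → ℤ) : List ℤ :=
  (List.range p).map fun t => d (p - t)

/-- `Δ` is PR over `K` with degree type `L`. Here `p` is the largest index for which some link in
`Δ` has nonzero `H̃_{p-1}`, for `0 ≤ i ≤ p` the faces whose links have nonzero `H̃_{i-1}` exist and
have size `s i`, and `L = (d_p, …, d_1)` with `d_i = s_{i-1} - s_i`. -/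
def HasDegreeType (K : Type*) [Field K] {V : Type*} [DecidableEq V] (Δ : Complex V)
    (L : List ℤ) : Prop :=
  IsPR K Δ ∧ ∃ (p : ℕ) (s : ℕ → ℕ),
    IsGreatest {i | (linkHomologySizes K Δ i).Nonempty} p ∧
    (∀ i ≤ p, linkHomologySizes K Δ i = {s i}) ∧
    L = descendingSeq p fun i => (s (i - 1) : ℤ) - (s i : ℤ)

/-! ### Intersection complexes

A sequence `(m_1, …, m_n)` is given by a function `m : ℕ → ℕ`, of which only the values
`m 1, …, m n` are used, and the index set `{1, …, n}` of the facets is `Fin n`. -/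

/-- The vertices `v_S^r` for nonempty `S ⊆ [n]` and `m_{|S|}` values of `r`. -/
abbrev IntersectionVertex (n : ℕ) (m : ℕ → ℕ) : Type :=
  Σ S : {S : Finset (Fin n) // S.Nonempty}, Fin (m S.1.card)

/-- The set `F_j` of all vertices `v_S^r` with `j ∈ S`. -/
def intersectionFacet (n : ℕ) (m : ℕ → ℕ) (j : Fin n) : Finset (IntersectionVertex n m) :=
  Finset.univ.filter fun v => j ∈ v.1.1

/-- The intersection complex `I(m_1, …, m_n) = ⟨F_1, …, F_n⟩`. -/
def intersectionComplex (n : ℕ) (m : ℕ → ℕ) : Complex (IntersectionVertex n m) :=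
  generated (intersectionFacet n m)

end PRComplex

/-! For a face `σ` let `J` index the facets containing it; the link is generated by the sets `F_j \
σ` with `j ∈ J`. If `σ` is smaller than the intersection of these facets, any further common vertex
is a cone point and the link is acyclic. If `σ` equals that intersection and is nonempty, a
subfamily of the `F_j \ σ` has a common vertex exactly when it is proper: the nerve is the boundary
of a simplex. If `σ = ∅`, all `n` facets occur and `T` of them meet exactly when `|T| ≤ p`: the
nerve is a skeleton of a simplex. Both cases fall under `exactAt_generatedOn_iff`, a nerve
computation by induction and Mayer–Vietoris. Hence homology in degree `i - 1` occurs exactly for `i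
≤ p` and faces that are intersections of `i + 1` facets (`nontrivial_reducedHomology_link_iff`).
Such an intersection has a size depending only on `i`, and Pascal's rule evaluates the successive
differences. -/

namespace PRComplex

/-! ### Chains of unions and intersections of complexes -/

section Chains

variable {K : Type*} [Field K] {V : Type*}

theorem single_mem_chains {Δ : Complex V} {k : ℕ} {σ : Finset V} (hσ : σ ∈ Δ) (hk : σ.card = k)
    (a : K) : Finsupp.single σ a ∈ chains K Δ k :=
  Finsupp.single_mem_supported K a ⟨hσ, hk⟩

theorem chains_mono {A B : Complex V} (h : A ≤ B) (k : ℕ) : chains K A k ≤ chains K B k :=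
  Finsupp.supported_mono fun _ hσ => ⟨h hσ.1, hσ.2⟩

theorem chains_sup (A B : Complex V) (k : ℕ) :
    chains K (A ⊔ B) k = chains K A k ⊔ chains K B k := by
  rw [chains, chains, chains, ← Finsupp.supported_union]
  congr 1
  ext σ
  simp only [LowerSet.mem_sup_iff, Set.mem_ofPred_eq, Set.mem_union]
  tauto

theorem chains_inf (A B : Complex V) (k : ℕ) :
    chains K (A ⊓ B) k = chains K A k ⊓ chains K B k := by
  rw [chains, chains, chains, ← Finsupp.supported_inter]
  congr 1
  ext σ
  simp only [LowerSet.mem_inf_iff, Set.mem_ofPred_eq, Set.mem_inter_iff]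
  tauto

/-- The complex generated by the sets `G j` with `j ∈ J`. -/
def generatedOn {ι : Type*} (J : Finset ι) (G : ι → Finset V) : Complex V where
  carrier := {τ | ∃ j ∈ J, τ ⊆ G j}
  lower' := fun _ _ hba ⟨j, hj, h⟩ => ⟨j, hj, hba.trans h⟩

theorem mem_generatedOn {ι : Type*} {J : Finset ι} {G : ι → Finset V} {τ : Finset V} :
    τ ∈ generatedOn J G ↔ ∃ j ∈ J, τ ⊆ G j :=
  Iff.rfl

theorem generatedOn_insert {ι : Type*} [DecidableEq ι] (J : Finset ι) (j : ι)
    (G : ι → Finset V) :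
    generatedOn (insert j J) G = generatedOn J G ⊔ generatedOn {j} G := by
  ext τ
  simp only [SetLike.mem_coe, LowerSet.mem_sup_iff, mem_generatedOn, Finset.mem_insert,
    Finset.mem_singleton, exists_eq_or_imp, exists_eq_left]
  exact or_comm

end Chains

/-! ### Exactness in one degree -/

section Homology

variable (K : Type*) [Field K] {V : Type*} [DecidableEq V]

/-- Every cycle with faces of size `k` is a boundary. -/
def ExactAt (Δ : Complex V) (k : ℕ) : Prop :=
  cycles K Δ k ≤ boundaries K Δ k

theorem nontrivial_reducedHomology_iff (Δ : Complex V) (k : ℕ) :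
    Nontrivial (ReducedHomology K Δ k) ↔ ¬ ExactAt K Δ k := by
  refine Submodule.Quotient.nontrivial_iff.trans ?_
  rw [ne_eq, Submodule.submoduleOf_eq_top]
  rfl

variable {K}

theorem boundary_mem_chains {Δ : Complex V} {k : ℕ} {c : Finset V →₀ K}
    (hc : c ∈ chains K Δ (k + 1)) : boundary K c ∈ chains K Δ k :=
  (boundaries_le_cycles K Δ k ⟨c, hc, rfl⟩).1

/-! ### Cones -/

variable (K) in
/-- The signed join with the vertex `v`. -/
noncomputable def cone (v : V) : (Finset V →₀ K) →ₗ[K] (Finset V →₀ K) :=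
  Finsupp.linearCombination K fun σ =>
    if v ∈ σ then 0 else Finsupp.single (insert v σ) ((-1 : K) ^ position σ v)

theorem cone_single (v : V) (σ : Finset V) (a : K) :
    cone K v (Finsupp.single σ a) =
      if v ∈ σ then 0 else Finsupp.single (insert v σ) (a * (-1 : K) ^ position σ v) := by
  rw [cone, Finsupp.linearCombination_single]
  split_ifs <;> simp

theorem position_insert_self (σ : Finset V) (v : V) : position (insert v σ) v = position σ v := by
  classical
  have h : ¬ WellOrderingRel v v := irrefl v
  simp only [position, Finset.filter_insert, if_neg h]

theorem position_insert_of_rel {σ : Finset V} {u v : V} (hv : v ∉ σ) (h : WellOrderingRel v u) :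
    position (insert v σ) u = position σ u + 1 := by
  rw [position_erase_of_rel (insert v σ) (Finset.mem_insert_self v σ) h,
    Finset.erase_insert hv]

theorem position_insert_of_not_rel {σ : Finset V} {u v : V} (h : ¬ WellOrderingRel v u) :
    position (insert v σ) u = position σ u := by
  classical
  simp only [position, Finset.filter_insert, if_neg h]

/-- Adding `v` and removing `u` anticommute: whichever of the two comes first shifts the position of
the other by one. -/
theorem sign_cone {σ : Finset V} {u v : V} (hu : u ∈ σ) (hv : v ∉ σ) :
    (-1 : K) ^ position σ v * (-1 : K) ^ position (insert v σ) u +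
      (-1 : K) ^ position σ u * (-1 : K) ^ position (σ.erase u) v = 0 := by
  rcases trichotomous_of (WellOrderingRel (α := V)) u v with h | h | h
  · rw [position_erase_of_rel σ hu h, position_insert_of_not_rel (asymm_of _ h)]
    ring
  · exact absurd (h ▸ hu) hv
  · rw [position_insert_of_rel hv h, position_erase_of_not_rel σ (asymm_of _ h)]
    ring

/-- The join with `v` is a contracting homotopy, so a complex closed under inserting `v` is acyclic.
-/
theorem boundary_cone_add_cone_boundary (v : V) (c : Finset V →₀ K) :
    boundary K (cone K v c) + cone K v (boundary K c) = c := by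
  suffices h : boundary K ∘ₗ cone K v + cone K v ∘ₗ boundary K = LinearMap.id from
    LinearMap.congr_fun h c
  refine Finsupp.lhom_ext fun σ a => ?_
  simp only [LinearMap.add_apply, LinearMap.comp_apply, LinearMap.id_apply, boundary_single,
    map_sum, cone_single]
  by_cases hv : v ∈ σ
  · rw [if_pos hv, map_zero, zero_add, Finset.sum_eq_single_of_mem v hv]
    · rw [if_neg (Finset.notMem_erase v σ), Finset.insert_erase hv,
        ← position_insert_self (σ.erase v), Finset.insert_erase hv, mul_assoc, ← pow_add,
        Even.neg_one_pow ⟨_, rfl⟩, mul_one]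
    · intro u _ huv
      rw [if_pos (Finset.mem_erase.mpr ⟨huv.symm, hv⟩)]
  · rw [if_neg hv, boundary_single, Finset.sum_insert hv, Finset.erase_insert hv,
      position_insert_self, mul_assoc, ← pow_add, Even.neg_one_pow ⟨_, rfl⟩, mul_one, add_assoc,
      ← Finset.sum_add_distrib, Finset.sum_eq_zero, add_zero]
    intro u hu
    have huv : v ≠ u := fun h => hv (h ▸ hu)
    rw [if_neg (fun h => hv (Finset.mem_of_mem_erase h)), Finset.erase_insert_of_ne huv,
      ← Finsupp.single_add, mul_assoc, mul_assoc, ← mul_add, sign_cone hu hv, mul_zero,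
      Finsupp.single_zero]

theorem cone_mem_chains {Δ : Complex V} {v : V} (hv : ∀ σ ∈ Δ, insert v σ ∈ Δ) {k : ℕ}
    {c : Finset V →₀ K} (hc : c ∈ chains K Δ k) : cone K v c ∈ chains K Δ (k + 1) := by
  rw [chains, Finsupp.supported_eq_span_single] at hc
  refine Submodule.span_induction (p := fun c _ => cone K v c ∈ chains K Δ (k + 1))
    ?_ (by simp) (fun x y _ _ hx hy => by rw [map_add]; exact add_mem hx hy)
    (fun a x _ hx => by rw [map_smul]; exact Submodule.smul_mem _ a hx) hc
  rintro _ ⟨σ, ⟨hσ, hk⟩, rfl⟩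
  change cone K v (Finsupp.single σ 1) ∈ _
  rw [cone_single]
  split_ifs with h
  · exact zero_mem _
  · exact single_mem_chains (hv σ hσ) (by rw [Finset.card_insert_of_notMem h, hk]) _

variable (K) in
theorem exactAt_of_cone {Δ : Complex V} {v : V} (hv : ∀ σ ∈ Δ, insert v σ ∈ Δ) (k : ℕ) :
    ExactAt K Δ k := by
  rintro c ⟨hc, hc0⟩
  refine ⟨cone K v c, cone_mem_chains hv hc, ?_⟩
  have h := boundary_cone_add_cone_boundary v c
  rwa [LinearMap.mem_ker.mp hc0, map_zero, add_zero] at h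

/-! ### Exactness in Mayer–Vietoris sequences -/

/-- Split a cycle as `a + b`. Then `∂a = -∂b` is a cycle of the intersection, hence `∂c` there, and
`a - c` and `b + c` are cycles that bound separately. -/
theorem exactAt_sup {A B : Complex V} {k : ℕ} (hA : ExactAt K A (k + 1))
    (hB : ExactAt K B (k + 1)) (hAB : ExactAt K (A ⊓ B) k) : ExactAt K (A ⊔ B) (k + 1) := by
  rintro z ⟨hz, hz0⟩
  rw [chains_sup] at hz
  obtain ⟨a, ha, b, hb, rfl⟩ := Submodule.mem_sup.mp hz
  have hab : boundary K a = -boundary K b := by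
    rw [SetLike.mem_coe, LinearMap.mem_ker, map_add] at hz0
    exact eq_neg_of_add_eq_zero_left hz0
  have hmem : boundary K a ∈ chains K (A ⊓ B) k := by
    rw [chains_inf]
    refine ⟨boundary_mem_chains ha, ?_⟩
    rw [hab]
    exact neg_mem (boundary_mem_chains hb)
  obtain ⟨c, hc, hca⟩ := hAB ⟨hmem, boundary_boundary K a⟩
  obtain ⟨a', ha', haa⟩ := hA (x := a - c)
    ⟨sub_mem ha (chains_mono inf_le_left _ hc), by
      rw [SetLike.mem_coe, LinearMap.mem_ker, map_sub, hca, sub_self]⟩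
  obtain ⟨b', hb', hbb⟩ := hB (x := b + c)
    ⟨add_mem hb (chains_mono inf_le_right _ hc), by
      rw [SetLike.mem_coe, LinearMap.mem_ker, map_add, hca, hab, add_neg_cancel]⟩
  refine ⟨a' + b', add_mem (chains_mono le_sup_left _ ha') (chains_mono le_sup_right _ hb'), ?_⟩
  rw [map_add, haa, hbb]
  abel

/-- The connecting map is onto: if a cycle of the intersection is `∂a` in `A` and `∂b` in `B`, and
`a - b` bounds in the union, then correcting `a` by a boundary from `A` moves it into the
intersection. -/
theorem not_exactAt_sup {A B : Complex V} {k : ℕ} (hA : ExactAt K A k)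
    (hB : ExactAt K B k) (hAB : ¬ ExactAt K (A ⊓ B) k) : ¬ ExactAt K (A ⊔ B) (k + 1) := by
  intro h
  refine hAB fun c ⟨hc, hc0⟩ => ?_
  obtain ⟨a, ha, hac⟩ := hA ⟨chains_mono inf_le_left _ hc, hc0⟩
  obtain ⟨b, hb, hbc⟩ := hB ⟨chains_mono inf_le_right _ hc, hc0⟩
  obtain ⟨w, hw, hwz⟩ := h (x := a - b)
    ⟨sub_mem (chains_mono le_sup_left _ ha) (chains_mono le_sup_right _ hb), by
      rw [SetLike.mem_coe, LinearMap.mem_ker, map_sub, hac, hbc, sub_self]⟩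
  rw [SetLike.mem_coe, chains_sup] at hw
  obtain ⟨a', ha', b', hb', rfl⟩ := Submodule.mem_sup.mp hw
  have hd : a - boundary K a' = b + boundary K b' := by
    rw [map_add] at hwz
    rw [sub_eq_iff_eq_add, add_assoc, add_comm (boundary K b'), hwz]
    abel
  refine ⟨a - boundary K a', ?_, ?_⟩
  · rw [SetLike.mem_coe, chains_inf]
    refine ⟨sub_mem ha (boundary_mem_chains ha'), ?_⟩
    rw [hd]
    exact add_mem hb (boundary_mem_chains hb')
  · rw [map_sub, boundary_boundary, sub_zero, hac]

/-- The Mayer–Vietoris lemmas only reach indices `k + 1`; this supplies index `0`. -/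
theorem exactAt_zero {Δ : Complex V} {v : V} (hv : {v} ∈ Δ) : ExactAt K Δ 0 := by
  rintro c ⟨hc, -⟩
  rw [chains, Finsupp.supported_eq_span_single] at hc
  refine Submodule.span_le.mpr ?_ hc
  rintro _ ⟨σ, ⟨-, hσ⟩, rfl⟩
  refine ⟨Finsupp.single {v} 1, single_mem_chains hv (by simp) 1, ?_⟩
  have hpos : position {v} v = 0 := by
    have h : ¬ WellOrderingRel v v := irrefl v
    simp [position, Finset.filter_singleton, h]
  rw [boundary_single]
  simp [hpos, Finset.card_eq_zero.mp hσ]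

theorem exactAt_iff_of_forall_eq_empty {Δ : Complex V} (h0 : ∅ ∈ Δ) (h : ∀ σ ∈ Δ, σ = ∅)
    (k : ℕ) : ExactAt K Δ k ↔ k ≠ 0 := by
  have hbot : ∀ k ≠ 0, chains K Δ k = ⊥ := by
    intro k hk
    have : {σ | σ ∈ Δ ∧ σ.card = k} = ∅ := by
      ext σ
      simp only [Set.mem_ofPred_eq, Set.mem_empty_iff_false, iff_false, not_and]
      intro hσ hc
      rw [h σ hσ, Finset.card_empty] at hc
      exact hk hc.symm
    rw [chains, this, Finsupp.supported_empty]
  constructor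
  · rintro hex rfl
    have hmem : Finsupp.single ∅ (1 : K) ∈ boundaries K Δ 0 :=
      hex ⟨single_mem_chains h0 rfl 1, by simp [LinearMap.mem_ker, boundary_single]⟩
    rw [boundaries, hbot _ (by simp), Submodule.map_bot, Submodule.mem_bot,
      Finsupp.single_eq_zero] at hmem
    exact one_ne_zero hmem
  · intro hk c hc
    have hc' := hc.1
    rw [SetLike.mem_coe, hbot k hk, Submodule.mem_bot] at hc'
    rw [hc']
    exact zero_mem _

/-! ### Complexes whose nerve is a skeleton of a simplex -/

variable (K) in
theorem exactAt_generatedOn_of_common {ι : Type*} {J : Finset ι} {G : ι → Finset V} {v : V}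
    (hv : ∀ j ∈ J, v ∈ G j) (k : ℕ) : ExactAt K (generatedOn J G) k :=
  exactAt_of_cone K (fun _ hσ => by
    obtain ⟨j, hj, h⟩ := hσ
    exact mem_generatedOn.mpr ⟨j, hj, Finset.insert_subset (hv j hj) h⟩) k

theorem generatedOn_inf_singleton {ι : Type*} (J : Finset ι) (j : ι) (G : ι → Finset V) :
    generatedOn J G ⊓ generatedOn {j} G = generatedOn J fun i => G i ∩ G j := by
  ext τ
  simp only [SetLike.mem_coe, LowerSet.mem_inf_iff, mem_generatedOn, Finset.mem_singleton,
    exists_eq_left, Finset.subset_inter_iff]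
  constructor
  · rintro ⟨⟨i, hi, h⟩, hj⟩
    exact ⟨i, hi, h, hj⟩
  · rintro ⟨i, hi, h, hj⟩
    exact ⟨⟨i, hi, h⟩, hj⟩

variable (K) in
/-- If exactly the intersections of at most `q` of the sets `G j` are nonempty, where `q` is less
than the number of sets, then they generate a complex with homology in a single degree. -/
theorem exactAt_generatedOn_iff {ι : Type*} [DecidableEq ι] (J : Finset ι) :
    ∀ (q : ℕ) (G : ι → Finset V), q < J.card →
      (∀ T ⊆ J, T.Nonempty → ((∃ v, ∀ j ∈ T, v ∈ G j) ↔ T.card ≤ q)) →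
      ∀ k, ExactAt K (generatedOn J G) k ↔ k ≠ q := by
  induction J using Finset.induction_on with
  | empty => intro q G hq; simp at hq
  | insert j J hj ih =>
    intro q G hq hG k
    rw [Finset.card_insert_of_notMem hj] at hq
    have hjmem := Finset.mem_insert_self j J
    have hGj := hG {j} (by simp) (by simp)
    -- For `q = 0` every `G i` is empty and the complex is `{∅}`.
    rcases q with _ | q
    · refine exactAt_iff_of_forall_eq_empty (mem_generatedOn.mpr ⟨j, hjmem, Finset.empty_subset _⟩) ?_ k
      rintro σ ⟨i, hi, hσ⟩
      have h := hG {i} (by simpa using hi) (by simp)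
      refine Finset.eq_empty_of_forall_notMem fun v hv => ?_
      have := h.mp ⟨v, by simpa using hσ hv⟩
      simp at this
    · obtain ⟨v, hv⟩ := hGj.mpr (by simp)
      have hB : ∀ k, ExactAt K (generatedOn {j} G) k := exactAt_generatedOn_of_common K hv
      -- A common vertex of the `G i ∩ G j` with `i ∈ T` is one of the family indexed by `insert j
      -- T`, so the bound drops by one.
      have hAB : ∀ k, ExactAt K (generatedOn J G ⊓ generatedOn {j} G) k ↔ k ≠ q := by
        rw [generatedOn_inf_singleton]
        refine ih q _ (by omega) fun T hT hTne => ?_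
        have h := hG (insert j T) (Finset.insert_subset_insert j hT) (by simp)
        rw [Finset.card_insert_of_notMem fun h => hj (hT h), Nat.add_le_add_iff_right] at h
        rw [← h]
        refine exists_congr fun w => ?_
        simp only [Finset.forall_mem_insert, Finset.mem_inter]
        obtain ⟨t, ht⟩ := hTne
        exact ⟨fun h => ⟨(h t ht).2, fun i hi => (h i hi).1⟩,
          fun h i hi => ⟨h.2 i hi, h.1⟩⟩
      have hA : ∀ k, k ≠ q + 1 → ExactAt K (generatedOn J G) k := by
        intro k hk
        -- Otherwise `J.card = q + 1`, so all `G i` with `i ∈ J` share a vertex and generate a cone.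
        rcases Nat.lt_or_ge (q + 1) J.card with hlt | hge
        · exact (ih (q + 1) G hlt
            (fun T hT => hG T (hT.trans (Finset.subset_insert j J))) k).mpr hk
        · obtain ⟨w, hw⟩ := (hG J (Finset.subset_insert j J)
            (Finset.card_pos.mp (by omega))).mpr hge
          exact exactAt_generatedOn_of_common K hw k
      rw [generatedOn_insert]
      rcases k with _ | k
      · refine iff_of_true (exactAt_zero (v := v) ?_) (by simp)
        rw [LowerSet.mem_sup_iff]
        exact Or.inr ⟨j, by simp, by simpa using hv⟩
      · by_cases hk : k = q
        · subst hk
          exact iff_of_false (not_exactAt_sup (hA k (by simp)) (hB k) (by simp [hAB]))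
            (by simp)
        · exact iff_of_true (exactAt_sup (hA _ (by simpa using hk)) (hB _) ((hAB k).mpr hk))
            (by simpa using hk)

end Homology

/-! ### Links in intersection complexes -/

section Intersection

variable {n : ℕ} {m : ℕ → ℕ}

variable (m) in
/-- The intersection of the facets `F_j` with `j ∈ J`. -/
def facetInter (J : Finset (Fin n)) : Finset (IntersectionVertex n m) :=
  Finset.univ.filter fun v => J ⊆ v.1.1

theorem mem_facetInter {J : Finset (Fin n)} {v : IntersectionVertex n m} :
    v ∈ facetInter m J ↔ J ⊆ v.1.1 := by
  simp [facetInter]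

theorem mem_intersectionFacet {j : Fin n} {v : IntersectionVertex n m} :
    v ∈ intersectionFacet n m j ↔ j ∈ v.1.1 := by
  simp [intersectionFacet]

theorem mem_intersectionComplex {σ : Finset (IntersectionVertex n m)} :
    σ ∈ intersectionComplex n m ↔ ∃ j, σ ⊆ intersectionFacet n m j := by
  simp [intersectionComplex, generated, mem_lowerClosure]

/-- The indices of the facets that contain `σ`. -/
def facetIndices (σ : Finset (IntersectionVertex n m)) : Finset (Fin n) :=
  Finset.univ.filter fun j => σ ⊆ intersectionFacet n m j

theorem mem_facetIndices {σ : Finset (IntersectionVertex n m)} {j : Fin n} :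
    j ∈ facetIndices σ ↔ σ ⊆ intersectionFacet n m j := by
  simp [facetIndices]

theorem subset_facetInter_iff {σ : Finset (IntersectionVertex n m)} {J : Finset (Fin n)} :
    σ ⊆ facetInter m J ↔ J ⊆ facetIndices σ := by
  simp only [Finset.subset_iff, mem_facetInter, mem_facetIndices, mem_intersectionFacet]
  tauto

theorem link_intersectionComplex (σ : Finset (IntersectionVertex n m)) :
    link (intersectionComplex n m) σ =
      generatedOn (facetIndices σ) fun j => intersectionFacet n m j \ σ := by
  ext τ
  change (τ ∈ intersectionComplex n m ∧ Disjoint σ τ ∧ σ ∪ τ ∈ intersectionComplex n m) ↔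
    ∃ j ∈ facetIndices σ, τ ⊆ intersectionFacet n m j \ σ
  simp only [mem_intersectionComplex, mem_facetIndices, Finset.union_subset_iff,
    Finset.subset_sdiff]
  constructor
  · rintro ⟨-, hd, j, h1, h2⟩
    exact ⟨j, h1, h2, hd.symm⟩
  · rintro ⟨j, h1, h2, hd⟩
    exact ⟨⟨j, h2⟩, hd.symm, j, h1, h2⟩

/-- Since `s < n`, the set `T` extends to a set of size `s` avoiding `j`. -/
theorem exists_mem_facetInter_notMem {s : ℕ} (hs : m s ≠ 0) (hs0 : 0 < s) (hsn : s < n)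
    {T : Finset (Fin n)} (hT : T.card ≤ s) {j : Fin n} (hj : j ∉ T) :
    ∃ v ∈ facetInter m T, j ∉ v.1.1 := by
  obtain ⟨S, hTS, hSj, hS⟩ := Finset.exists_subsuperset_card_eq
    (s := T) (t := Finset.univ.erase j) (n := s)
    (fun i hi => Finset.mem_erase.mpr ⟨fun h => hj (h ▸ hi), Finset.mem_univ i⟩) hT
    (by rw [Finset.card_erase_of_mem (Finset.mem_univ j), Finset.card_univ, Fintype.card_fin]
        omega)
  subst hS
  exact ⟨⟨⟨S, Finset.card_pos.mp hs0⟩, ⟨0, Nat.pos_of_ne_zero hs⟩⟩, mem_facetInter.mpr hTS,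
    fun h => Finset.notMem_erase j _ (hSj h)⟩

theorem m_card_ne_zero (v : IntersectionVertex n m) : m v.1.1.card ≠ 0 :=
  (Fin.pos v.2).ne'

theorem card_lt (hn : m n = 0) (v : IntersectionVertex n m) : v.1.1.card < n := by
  refine lt_of_le_of_ne (by simpa using Finset.card_le_univ v.1.1) fun h => m_card_ne_zero v ?_
  rw [h, hn]

/-- A vertex of the smaller intersection supplies a size `s ≥ |J|` with `m s ≠ 0`, and `m n = 0`
forces `s < n`. Thus a nonempty intersection of facets determines its index set. -/
theorem exists_facetInter_mem_notMem (hn : m n = 0) {T J : Finset (Fin n)} (hTJ : T ⊂ J)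
    (hJ : (facetInter m J).Nonempty) : ∃ v ∈ facetInter m T, v ∉ facetInter m J := by
  obtain ⟨w, hw⟩ := hJ
  obtain ⟨j, hj, hjT⟩ := Finset.exists_of_ssubset hTJ
  obtain ⟨v, hv, hvj⟩ := exists_mem_facetInter_notMem (m_card_ne_zero w)
    (Finset.card_pos.mpr w.1.2) (card_lt hn w)
    ((Finset.card_le_card hTJ.1).trans (Finset.card_le_card (mem_facetInter.mp hw))) hjT
  exact ⟨v, hv, fun h => hvj (mem_facetInter.mp h hj)⟩

theorem lt_of_isGreatest (hn : m n = 0) {p : ℕ}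
    (hp : IsGreatest {j : ℕ | j ∈ Finset.Icc 1 n ∧ m j ≠ 0} p) : p < n := by
  obtain ⟨⟨hpI, hmp⟩, -⟩ := hp
  refine lt_of_le_of_ne (Finset.mem_Icc.mp hpI).2 fun h => hmp ?_
  rw [h, hn]

theorem card_le_of_isGreatest {p : ℕ}
    (hp : IsGreatest {j : ℕ | j ∈ Finset.Icc 1 n ∧ m j ≠ 0} p) (v : IntersectionVertex n m) :
    v.1.1.card ≤ p :=
  hp.2 ⟨Finset.mem_Icc.mpr ⟨Finset.card_pos.mpr v.1.2, by simpa using Finset.card_le_univ v.1.1⟩,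
    m_card_ne_zero v⟩

theorem facetInter_nonempty_iff (hn : m n = 0) {p : ℕ}
    (hp : IsGreatest {j : ℕ | j ∈ Finset.Icc 1 n ∧ m j ≠ 0} p) (T : Finset (Fin n)) :
    (facetInter m T).Nonempty ↔ T.card ≤ p := by
  constructor
  · rintro ⟨v, hv⟩
    exact (Finset.card_le_card (mem_facetInter.mp hv)).trans (card_le_of_isGreatest hp v)
  · intro hT
    have hpn := lt_of_isGreatest hn hp
    obtain ⟨j, hj⟩ : ∃ j, j ∉ T := by
      by_contra! h
      rw [Finset.eq_univ_of_forall h, Finset.card_univ, Fintype.card_fin] at hT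
      omega
    obtain ⟨v, hv, -⟩ := exists_mem_facetInter_notMem hp.1.2
      (Finset.mem_Icc.mp hp.1.1).1 hpn hT hj
    exact ⟨v, hv⟩

/-- The link of a face of the intersection complex has nonzero homology exactly when the face is an
intersection of facets. -/
theorem nontrivial_reducedHomology_link_iff (K : Type*) [Field K] (hn : m n = 0) {p : ℕ}
    (hp : IsGreatest {j : ℕ | j ∈ Finset.Icc 1 n ∧ m j ≠ 0} p)
    {σ : Finset (IntersectionVertex n m)} (hσ : σ ∈ intersectionComplex n m) (i : ℕ) :
    Nontrivial (ReducedHomology K (link (intersectionComplex n m) σ) i) ↔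
      i ≤ p ∧ ∃ J : Finset (Fin n), J.card = i + 1 ∧ σ = facetInter m J := by
  have hpn := lt_of_isGreatest hn hp
  rw [nontrivial_reducedHomology_iff, link_intersectionComplex]
  rcases σ.eq_empty_or_nonempty with rfl | hne
  · have huniv : facetIndices (∅ : Finset (IntersectionVertex n m)) = Finset.univ := by
      ext j
      simp [mem_facetIndices]
    rw [exactAt_generatedOn_iff K _ p _ (by simpa [huniv] using hpn), not_not]
    · constructor
      · rintro rfl
        obtain ⟨J, -, hJ⟩ := Finset.exists_subset_card_eq
          (s := (Finset.univ : Finset (Fin n))) (n := i + 1) (by simpa using hpn)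
        refine ⟨le_rfl, J, hJ, (Finset.not_nonempty_iff_eq_empty.mp ?_).symm⟩
        rw [facetInter_nonempty_iff hn hp]
        omega
      · rintro ⟨hip, J, hJ, hJe⟩
        -- An empty intersection needs more than `p` facets, so `i ≤ p` leaves only `i = p`.
        have h := mt (facetInter_nonempty_iff hn hp J).mpr (by simp [← hJe])
        omega
    · intro T _ _
      rw [← facetInter_nonempty_iff hn hp]
      refine exists_congr fun v => ?_
      simp [mem_facetInter, mem_intersectionFacet, Finset.subset_iff]
  · have hsub : σ ⊆ facetInter m (facetIndices σ) := subset_facetInter_iff.mpr subset_rfl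
    by_cases heq : σ = facetInter m (facetIndices σ)
    · have hne' := heq ▸ hne
      have hpos : 0 < (facetIndices σ).card := by
        obtain ⟨j, hj⟩ := mem_intersectionComplex.mp hσ
        exact Finset.card_pos.mpr ⟨j, mem_facetIndices.mpr hj⟩
      have hle := (facetInter_nonempty_iff hn hp _).mp hne'
      -- Only the full family lacks a common vertex outside `σ`, so the bound is one less than the
      -- number of facets.
      rw [exactAt_generatedOn_iff K _ ((facetIndices σ).card - 1) _ (by omega), not_not]
      · constructor
        · rintro rfl
          exact ⟨by omega, facetIndices σ, by omega, heq⟩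
        · rintro ⟨-, J, hJ, hJe⟩
          have hJs : J ⊆ facetIndices σ := subset_facetInter_iff.mp hJe.subset
          have : J = facetIndices σ := by
            by_contra h
            obtain ⟨v, hv, hv'⟩ := exists_facetInter_mem_notMem hn
              (Finset.ssubset_iff_subset_ne.mpr ⟨hJs, h⟩) hne'
            rw [← heq, hJe] at hv'
            exact hv' hv
          rw [← this]
          omega
      · intro T hT _
        have key : (∃ v, ∀ j ∈ T, v ∈ intersectionFacet n m j \ σ) → T ≠ facetIndices σ := by
          rintro ⟨v, hv⟩ rfl
          obtain ⟨j, hj⟩ := Finset.card_pos.mp hpos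
          refine (Finset.mem_sdiff.mp (hv j hj)).2 ?_
          rw [heq, mem_facetInter]
          exact fun i hi => mem_intersectionFacet.mp (Finset.mem_sdiff.mp (hv i hi)).1
        constructor
        · intro h
          have := Finset.card_lt_card (Finset.ssubset_iff_subset_ne.mpr ⟨hT, key h⟩)
          omega
        · intro h
          have hss : T ⊂ facetIndices σ := Finset.ssubset_iff_subset_ne.mpr
            ⟨hT, fun h' => by rw [h'] at h; omega⟩
          obtain ⟨v, hv, hv'⟩ := exists_facetInter_mem_notMem hn hss hne'
          rw [← heq] at hv'
          exact ⟨v, fun j hj => Finset.mem_sdiff.mpr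
            ⟨mem_intersectionFacet.mpr (mem_facetInter.mp hv hj), hv'⟩⟩
    · obtain ⟨v, hv, hvσ⟩ := Finset.exists_of_ssubset
        (Finset.ssubset_iff_subset_ne.mpr ⟨hsub, heq⟩)
      refine iff_of_false (not_not.mpr (exactAt_generatedOn_of_common K (v := v)
        (fun j hj => Finset.mem_sdiff.mpr
          ⟨mem_intersectionFacet.mpr (mem_facetInter.mp hv hj), hvσ⟩) i)) ?_
      rintro ⟨-, J, -, hJ⟩
      refine heq (hsub.antisymm fun w hw => ?_)
      rw [hJ, mem_facetInter]
      exact (subset_facetInter_iff.mp hJ.subset).trans (mem_facetInter.mp hw)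

/-- Sets `S ⊇ J` correspond to subsets `S \ J` of the complement, grouped by size. Nonemptiness of
`J` makes every such `S` admissible as a vertex label. -/
theorem card_facetInter {J : Finset (Fin n)} (hJ : J.Nonempty) :
    (facetInter m J).card =
      ∑ j ∈ Finset.range (n - J.card + 1), (n - J.card).choose j * m (J.card + j) := by
  have h1 : (facetInter m J).card =
      ∑ S : {S : Finset (Fin n) // S.Nonempty}, if J ⊆ S.1 then m S.1.card else 0 := by
    have : facetInter m J = (Finset.univ.filter
        fun S : {S : Finset (Fin n) // S.Nonempty} => J ⊆ S.1).sigma fun _ => Finset.univ := by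
      ext v
      simp [mem_facetInter]
    rw [this, Finset.card_sigma, Finset.sum_filter]
    simp
  have h2 : (∑ S : {S : Finset (Fin n) // S.Nonempty}, if J ⊆ S.1 then m S.1.card else 0) =
      ∑ U ∈ (Jᶜ).powerset, m (J.card + U.card) := by
    rw [← Finset.sum_filter]
    refine Finset.sum_bij' (fun S _ => S.1 \ J) (fun U _ => ⟨J ∪ U, hJ.mono (by simp)⟩)
      ?_ ?_ ?_ ?_ ?_
    · intro S _
      simp [Finset.subset_iff]
    · intro U _
      simp
    · intro S hS
      exact Subtype.ext (Finset.union_sdiff_of_subset (Finset.mem_filter.mp hS).2)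
    · intro U hU
      have hd : Disjoint J U := (Finset.subset_compl_iff_disjoint_left.mp
        (Finset.mem_powerset.mp hU))
      exact Finset.union_sdiff_cancel_left hd
    · intro S hS
      rw [add_comm, Finset.card_sdiff_add_card_eq_card (Finset.mem_filter.mp hS).2]
  rw [h1, h2, Finset.sum_powerset_apply_card (fun u => m (J.card + u)), Finset.card_compl,
    Fintype.card_fin]
  simp

end Intersection

/-! ### The degree type -/

/-- The number of vertices `v_S^r` with `J ⊆ S`, for any given `J` of size `i + 1`. -/
def facetInterSize (n : ℕ) (m : ℕ → ℕ) (i : ℕ) : ℕ :=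
  ∑ j ∈ Finset.range (n - (i + 1) + 1), (n - (i + 1)).choose j * m (i + 1 + j)

theorem linkHomologySizes_intersectionComplex (K : Type*) [Field K] {n : ℕ} {m : ℕ → ℕ}
    (hn : m n = 0) {p : ℕ} (hp : IsGreatest {j : ℕ | j ∈ Finset.Icc 1 n ∧ m j ≠ 0} p) (i : ℕ) :
    linkHomologySizes K (intersectionComplex n m) i =
      {s | i ≤ p ∧ s = facetInterSize n m i} := by
  have hcard {J : Finset (Fin n)} (hJ : J.card = i + 1) :
      (facetInter m J).card = facetInterSize n m i := by
    rw [card_facetInter (Finset.card_pos.mp (by omega)), hJ, facetInterSize]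
  ext s
  constructor
  · rintro ⟨σ, hσ, hnt, rfl⟩
    obtain ⟨hi, J, hJ, rfl⟩ := (nontrivial_reducedHomology_link_iff K hn hp hσ i).mp hnt
    exact ⟨hi, hcard hJ⟩
  · rintro ⟨hi, rfl⟩
    have hpn := lt_of_isGreatest hn hp
    obtain ⟨J, -, hJ⟩ := Finset.exists_subset_card_eq
      (s := (Finset.univ : Finset (Fin n))) (n := i + 1)
      (by rw [Finset.card_univ, Fintype.card_fin]; omega)
    have hmem : facetInter m J ∈ intersectionComplex n m := by
      obtain ⟨j, hj⟩ := Finset.card_pos.mp (by omega : 0 < J.card)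
      exact mem_intersectionComplex.mpr
        ⟨j, fun v hv => mem_intersectionFacet.mpr (mem_facetInter.mp hv hj)⟩
    exact ⟨facetInter m J, hmem,
      (nontrivial_reducedHomology_link_iff K hn hp hmem i).mpr ⟨hi, J, hJ, rfl⟩, hcard hJ⟩

theorem sum_choose_succ_mul (r : ℕ) (f : ℕ → ℤ) :
    ∑ j ∈ Finset.range (r + 2), ((r + 1).choose j : ℤ) * f j =
      ∑ j ∈ Finset.range (r + 1), (r.choose j : ℤ) * f j +
        ∑ j ∈ Finset.range (r + 1), (r.choose j : ℤ) * f (j + 1) := by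
  -- The added top term vanishes because `r.choose (r + 1) = 0`.
  have hlast : ∑ j ∈ Finset.range (r + 1), (r.choose j : ℤ) * f j =
      ∑ j ∈ Finset.range (r + 2), (r.choose j : ℤ) * f j := by
    rw [Finset.sum_range_succ _ (r + 1), Nat.choose_succ_self]
    simp
  rw [hlast, Finset.sum_range_succ', Finset.sum_range_succ' _ (r + 1), add_right_comm,
    ← Finset.sum_add_distrib]
  congr 1
  · refine Finset.sum_congr rfl fun j _ => ?_
    rw [Nat.choose_succ_succ]
    push_cast
    ring
  · simp

/-- With `r = n - i - 1`, Pascal's rule splits the size at `i - 1` into the claimed sum and a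
shifted sum, which is the size at `i`. -/
theorem facetInterSize_sub {n : ℕ} (m : ℕ → ℕ) {i : ℕ} (hi : 1 ≤ i) (hin : i < n) :
    (facetInterSize n m (i - 1) : ℤ) - (facetInterSize n m i : ℤ) =
      ∑ j ∈ Finset.range (n - i), ((n - i - 1).choose j : ℤ) * (m (i + j) : ℤ) := by
  obtain ⟨r, rfl⟩ : ∃ r, n = i + r + 1 := ⟨n - i - 1, by omega⟩
  have e1 : i + r + 1 - i = r + 1 := by omega
  have e2 : i + r + 1 - (i + 1) = r := by omega
  rw [sub_eq_iff_eq_add]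
  simp only [facetInterSize, Nat.sub_add_cancel hi, e1, e2, Nat.add_sub_cancel]
  push_cast
  rw [sum_choose_succ_mul r fun j => (m (i + j) : ℤ)]
  simp only [add_assoc, add_comm 1]

end PRComplex

theorem mainTheorem4 (K : Type*) [Field K] (n : ℕ) (m : ℕ → ℕ)
    (hm : ∃ j ∈ Finset.Icc 1 n, m j ≠ 0) (hn : m n = 0)
    (p : ℕ) (hp : IsGreatest {j : ℕ | j ∈ Finset.Icc 1 n ∧ m j ≠ 0} p) :
    PRComplex.IsPR K (PRComplex.intersectionComplex n m) ∧
    PRComplex.HasDegreeType K (PRComplex.intersectionComplex n m)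
      (PRComplex.descendingSeq p fun i =>
        ∑ j ∈ Finset.range (n - i), ((n - i - 1).choose j : ℤ) * (m (i + j) : ℤ)) := by
  have hsizes := PRComplex.linkHomologySizes_intersectionComplex K hn hp
  have hPR : PRComplex.IsPR K (PRComplex.intersectionComplex n m) := by
    intro i σ hσ τ hτ hσi hτi
    have h1 : σ.card ∈ PRComplex.linkHomologySizes K (PRComplex.intersectionComplex n m) i :=
      ⟨σ, hσ, hσi, rfl⟩
    have h2 : τ.card ∈ PRComplex.linkHomologySizes K (PRComplex.intersectionComplex n m) i :=
      ⟨τ, hτ, hτi, rfl⟩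
    rw [hsizes] at h1 h2
    exact h1.2.trans h2.2.symm
  refine ⟨hPR, hPR, p, PRComplex.facetInterSize n m, ⟨?_, ?_⟩, ?_, ?_⟩
  · rw [Set.mem_ofPred_eq, hsizes]
    exact ⟨_, le_rfl, rfl⟩
  · intro i hi
    rw [Set.mem_ofPred_eq, hsizes] at hi
    obtain ⟨_, hi, -⟩ := hi
    exact hi
  · intro i hi
    rw [hsizes]
    ext s
    simp [hi]
  · have hpn := PRComplex.lt_of_isGreatest hn hp
    refine List.map_congr_left fun t ht => ?_
    rw [List.mem_range] at ht
    exact (PRComplex.facetInterSize_sub m (by omega) (by omega)).symm
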